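/- Let $p$ be a prime and $|\cdot|$ the absolute value of $\mathbb{C}_p$ with $|p|=1/p$. **The Berkovich side.** $\mathbb{A}^1_{\mathrm{Berk}}$ is the set of multiplicative seminorms on $\mathbb{C}_p[T]$ extending $|\cdot|$, with the coarsest topology making all maps $x\mapsto |f|_x$ continuous, and $\mathbb{P}^1_{\mathrm{Berk}}=\mathbb{A}^1_{\mathrm{Berk}}\cup\{\infty\}$ is its one-point compactification. The point of a closed disk $(a,r)=\{z\in\mathbb{C}_p:|z-a|\le r\}$ is the seminorm $f\mapsto \sup_{|z-a|\le r}|f(z)|$. Type II points (their set is $\mathbf{H}^{\mathbb{Q}}_{\mathrm{Berk}}$) are the disks with $r\in|\mathbb{C}_p^\times|$; type I points are the disks $(a,0)$ and the point $\infty$, whose disk is taken to be all of $\mathbb{C}_p$ (radius $\infty$). Sets of points of $\mathbb{P}^1_{\mathrm{Berk}}$ carry the subspace topology. **The space $W$.** On $\mathbb{C}_p^\times\times\mathbb{C}_p$ let $(z_0,z)\sim(w_0,w)$ if and only if $$u(z_0,z;w_0,w)=\frac{\max(|z_0-w_0|,|z-w|)^2}{|z_0w_0|}\le 1 .$$ This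 is an equivalence relation, and its quotient is $\mathrm{Bulk}(W)$. For $\omega\in\mathbb{Q}$ let $(p^{\omega},z)$ denote the class of $(z_0,z)$ for any $z_0\in\mathbb{C}_p^\times$ that is a value of $p^\omega$; its depth is $\omega$. The space $W$ is $\mathrm{Bulk}(W)$ together with the boundary points $(p^{\infty},z)=(\infty,z)$, one for each $z\in\mathbb{C}_p$, of depth $\infty$, and one further point $(p^{-\infty},0)=(0,0)$ of depth $-\infty$. The branch leading to $w\in\mathbb{C}_p$ consists of all points $(p^\omega,w)$ with $\omega\in\mathbb{Q}\cup\{\infty\}$ and of $(p^{-\infty},0)$. A point $x$ is on the path from $y$ toward the boundary (and $y$ is an ancestor of $x$) if some branch contains both and the depth of $x$ is at least that of $y$. The path $[x,y]$ is the set of all $t$ that are ancestors of $x$ or of $y$ and of which every common ancestor of $x$ and $y$ is an ancestor. $W$ carries the tree topology, with subbasis the sets $\{y: t\notin[x,y]\}$ for $t,x\in W$, and $\mathrm{Bulk}(W)$ the subspace topology. **Theorem.** Every type II point is a disk $(a,p^i)$ with $a\in\mathbb{C}_p$, $i\in\mathbb{Q}$, and every point of $\mathrm{Bulk}(W)$ is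 of the form $(p^\omega,z)$ with $\omega\in\mathbb{Q}$, $z\in\mathbb{C}_p$. 1. The map $$\varphi:\mathbf{H}^{\mathbb{Q}}_{\mathrm{Berk}}\to\mathrm{Bulk}(W),\qquad (a,p^i)\mapsto(p^{-i},a),$$ is a well-defined homeomorphism, with inverse $(p^\omega,z)\mapsto(z,p^{-\omega})$. 2. With the conventions $p^{-\infty}=0$ and $p^{\infty}=\infty$, it extends to a homeomorphism $\Phi$ from the set of all type I and type II points onto $W$, with $\Phi(a,0)=(\infty,a)$ for $a\in\mathbb{C}_p$ and $\Phi(\infty)=(0,0)$. 3. For points $x,y$ of type I or II, the disk of $x$ is contained in the disk of $y$ if and only if $\Phi(x)$ is on the path from $\Phi(y)$ toward the boundary of $W$. 4. $\varphi$ is also an isometry, and hence a homeomorphism, for the path metrics: the function $\rho(x,y)=i_1+i_2-2i_3$ on $\mathrm{Bulk}(W)$, where $i_1,i_2$ are the depths of $x,y$ and $i_3$ is the largest depth of a common ancestor of $x$ and $y$ in $\mathrm{Bulk}(W)$, and the function $2\log_p\max(r,s,|a-b|)-\log_p r-\log_p s$ of type II points $(a,r),(b,s)$, are metrics, and $\varphi$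 carries the second to the first. -/

import Mathlib

open scoped Polynomial OnePoint

noncomputable section

namespace PadicBulk

/-! ### The Berkovich projective line over `ℂ_[p]` -/

/-- The Berkovich affine line over `ℂ_[p]`: multiplicative seminorms on `ℂ_[p][X]` that extend the
absolute value of `ℂ_[p]`. -/
def BerkAffine (p : ℕ) [Fact p.Prime] : Type :=
  {x : MulRingSeminorm ℂ_[p][X] // ∀ c : ℂ_[p], x (Polynomial.C c) = ‖c‖}

/-- The Berkovich topology: the coarsest topology for which every evaluation `x ↦ |f|_x` is
continuous. -/
instance (p : ℕ) [Fact p.Prime] : TopologicalSpace (BerkAffine p) :=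
  TopologicalSpace.induced (fun x (f : ℂ_[p][X]) => x.1 f) inferInstance

/-- The Berkovich projective line, the one-point compactification of the affine line. -/
abbrev BerkProj (p : ℕ) [Fact p.Prime] : Type := OnePoint (BerkAffine p)

/-- `x` is the point of the closed disk `B(a, r)`, that is, `|f|_x = sup_{z ∈ B(a, r)} |f(z)|` for
every polynomial `f`. -/
def IsDiskPoint {p : ℕ} [Fact p.Prime] (x : BerkProj p) (a : ℂ_[p]) (r : ℝ) : Prop :=
  ∃ y : BerkAffine p, x = (y : BerkProj p) ∧
    ∀ f : ℂ_[p][X], IsLUB ((fun z => ‖f.eval z‖) '' Metric.closedBall a r) (y.1 f)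

/-- Type I points: the points of `ℂ_[p]`, seen as disks of radius `0`, and the point at infinity. -/
def IsTypeI {p : ℕ} [Fact p.Prime] (x : BerkProj p) : Prop :=
  x = ∞ ∨ ∃ a : ℂ_[p], IsDiskPoint x a 0

/-- Type II points: the closed disks with radius in the value group `|ℂ_[p]ˣ|`. -/
def IsTypeII {p : ℕ} [Fact p.Prime] (x : BerkProj p) : Prop :=
  ∃ (a : ℂ_[p]) (c : ℂ_[p]ˣ), IsDiskPoint x a ‖(c : ℂ_[p])‖

/-- The set of type II points, with the subspace topology. -/
abbrev HQ (p : ℕ) [Fact p.Prime] : Type := {x : BerkProj p // IsTypeII x}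

/-- The set of type I and type II points, with the subspace topology. -/
abbrev TypeIOrII (p : ℕ) [Fact p.Prime] : Type := {x : BerkProj p // IsTypeI x ∨ IsTypeII x}

/-- `B` is the disk of `x`; the disk of the point at infinity (radius `p ^ ∞ = ∞`) is all of
`ℂ_[p]`. -/
def IsDiskOf {p : ℕ} [Fact p.Prime] (x : BerkProj p) (B : Set ℂ_[p]) : Prop :=
  (x = ∞ ∧ B = Set.univ) ∨ ∃ (a : ℂ_[p]) (r : ℝ), IsDiskPoint x a r ∧ B = Metric.closedBall a r

/-! ### The coarse-graining of `ℂ_[p]ˣ × ℂ_[p]` -/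

/-- The chordal distance `u`. -/
def chordalDist {p : ℕ} [Fact p.Prime] (x y : ℂ_[p]ˣ × ℂ_[p]) : ℝ :=
  (max ‖(x.1 : ℂ_[p]) - y.1‖ ‖x.2 - y.2‖) ^ 2 / ‖(x.1 : ℂ_[p]) * y.1‖

theorem chordalDist_le_one_iff {p : ℕ} [Fact p.Prime] (x y : ℂ_[p]ˣ × ℂ_[p]) :
    chordalDist x y ≤ 1 ↔
      ‖(x.1 : ℂ_[p])‖ = ‖(y.1 : ℂ_[p])‖ ∧ ‖x.2 - y.2‖ ≤ ‖(x.1 : ℂ_[p])‖ := by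
  have hx : 0 < ‖(x.1 : ℂ_[p])‖ := norm_pos_iff.2 x.1.ne_zero
  have hy : 0 < ‖(y.1 : ℂ_[p])‖ := norm_pos_iff.2 y.1.ne_zero
  have h1 := le_max_left ‖(x.1 : ℂ_[p]) - y.1‖ ‖x.2 - y.2‖
  have h2 := le_max_right ‖(x.1 : ℂ_[p]) - y.1‖ ‖x.2 - y.2‖
  have h3 := norm_nonneg ((x.1 : ℂ_[p]) - y.1)
  have h4 := norm_nonneg (x.2 - y.2)
  unfold chordalDist
  rw [norm_mul, div_le_one (mul_pos hx hy)]
  constructor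
  · intro h
    have he : ‖(x.1 : ℂ_[p])‖ = ‖(y.1 : ℂ_[p])‖ := by
      by_contra hne
      have h5 := IsUltrametricDist.norm_add_eq_max_of_norm_ne_norm
        (x := (x.1 : ℂ_[p])) (y := -(y.1 : ℂ_[p])) (by rwa [norm_neg])
      rw [← sub_eq_add_neg, norm_neg] at h5
      rcases lt_or_gt_of_ne hne with hl | hl
      · rw [max_eq_right hl.le] at h5
        nlinarith
      · rw [max_eq_left hl.le] at h5
        nlinarith
    refine ⟨he, ?_⟩
    rw [← he] at h
    exact h2.trans (abs_le_of_sq_le_sq' (by nlinarith) hx.le).2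
  · rintro ⟨he, h⟩
    have h6 : ‖(x.1 : ℂ_[p]) - y.1‖ ≤ ‖(x.1 : ℂ_[p])‖ := by
      have := IsUltrametricDist.norm_add_le_max (x.1 : ℂ_[p]) (-(y.1 : ℂ_[p]))
      rwa [← sub_eq_add_neg, norm_neg, ← he, max_self] at this
    have h7 := max_le h6 h
    rw [← he]
    nlinarith [h3.trans h1]

/-- `(z₀, z) ∼ (w₀, w)` if and only if their chordal distance is at most `1`. -/
def coarseSetoid (p : ℕ) [Fact p.Prime] : Setoid (ℂ_[p]ˣ × ℂ_[p]) where
  r x y := chordalDist x y ≤ 1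
  iseqv :=
    { refl := fun x => (chordalDist_le_one_iff x x).2 ⟨rfl, by simp⟩
      symm := fun {x y} h => by
        rw [chordalDist_le_one_iff] at h ⊢
        exact ⟨h.1.symm, by rw [norm_sub_rev, ← h.1]; exact h.2⟩
      trans := fun {x y z} h h' => by
        rw [chordalDist_le_one_iff] at h h' ⊢
        refine ⟨h.1.trans h'.1, ?_⟩
        rw [← sub_add_sub_cancel x.2 y.2 z.2]
        exact (IsUltrametricDist.norm_add_le_max _ _).trans
          (max_le h.2 (h'.2.trans h.1.ge)) }

/-- The bulk of `W`: the quotient of `ℂ_[p]ˣ × ℂ_[p]` by the coarse-graining relation. -/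
def Bulk (p : ℕ) [Fact p.Prime] : Type := Quotient (coarseSetoid p)

/-- The class of `(z₀, z)`. -/
def Bulk.mk {p : ℕ} [Fact p.Prime] (z₀ : ℂ_[p]ˣ) (z : ℂ_[p]) : Bulk p :=
  Quotient.mk (coarseSetoid p) (z₀, z)

/-- The depth `ω` of a bulk point `(p ^ ω, z)`, that is, the valuation of its first coordinate. -/
def Bulk.depth {p : ℕ} [Fact p.Prime] : Bulk p → ℝ :=
  Quotient.lift (fun x : ℂ_[p]ˣ × ℂ_[p] => -Real.logb p ‖(x.1 : ℂ_[p])‖) fun x y h => by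
    have h' := ((chordalDist_le_one_iff x y).1 h).1
    simp only [h']

/-- `z₀` is a value of the rational power `p ^ ω` in `ℂ_[p]`. -/
def IsRatPow {p : ℕ} [Fact p.Prime] (z₀ : ℂ_[p]ˣ) (ω : ℚ) : Prop :=
  (z₀ : ℂ_[p]) ^ ω.den = (p : ℂ_[p]) ^ ω.num

/-- The whole space `W`: the bulk together with its boundary. -/
inductive W (p : ℕ) [Fact p.Prime] : Type
  /-- A bulk point. -/
  | bulk (q : Bulk p) : W p
  /-- The boundary point `(p ^ ∞, z) = (∞, z)`, at the end of the branch that leads to `z`. -/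
  | bdry (z : ℂ_[p]) : W p
  /-- The boundary point `(p ^ (-∞), 0) = (0, 0)`, at the other end of the trunk. -/
  | root : W p

/-- The depth `ω ∈ ℝ ∪ {±∞}` of a point `(p ^ ω, z)`. -/
def W.depth {p : ℕ} [Fact p.Prime] : W p → EReal
  | .bulk q => (q.depth : EReal)
  | .bdry _ => ⊤
  | .root => ⊥

/-- The branch that leads to `w ∈ ℂ_[p]` consists of all points `(p ^ ω, w)`, `-∞ ≤ ω ≤ ∞`. -/
def W.OnBranch {p : ℕ} [Fact p.Prime] (w : ℂ_[p]) : W p → Prop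
  | .bulk q => ∃ z₀ : ℂ_[p]ˣ, q = Bulk.mk z₀ w
  | .bdry z => z = w
  | .root => True

/-- `x` lies on the path from `y` toward the boundary: some branch contains both, and `x` is at
least as deep as `y`. -/
def W.OnPathToBdry {p : ℕ} [Fact p.Prime] (x y : W p) : Prop :=
  y.depth ≤ x.depth ∧ ∃ w : ℂ_[p], x.OnBranch w ∧ y.OnBranch w

/-- The path between `x` and `y` in the tree `W`: it climbs from `x` and from `y` up to their
highest common ancestor. -/
def W.path {p : ℕ} [Fact p.Prime] (x y : W p) : Set (W p) :=
  {t | (x.OnPathToBdry t ∨ y.OnPathToBdry t) ∧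
    ∀ u : W p, x.OnPathToBdry u → y.OnPathToBdry u → t.OnPathToBdry u}

/-- The tree topology of `W`. A subbasis is given by the branches at the points `t`: the set of all
`y` that can be joined to a given `x` by a path that avoids `t`. -/
instance (p : ℕ) [Fact p.Prime] : TopologicalSpace (W p) :=
  TopologicalSpace.generateFrom {U | ∃ t x : W p, U = {y | t ∉ W.path x y}}

/-- The bulk carries the subspace topology. -/
instance (p : ℕ) [Fact p.Prime] : TopologicalSpace (Bulk p) :=
  TopologicalSpace.induced W.bulk inferInstance

/-- The path distance `i₁ + i₂ - 2 i₃` of two bulk points of depths `i₁` and `i₂`, where `i₃` is the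
depth of their highest (that is, deepest) common ancestor. -/
def Bulk.pathDist {p : ℕ} [Fact p.Prime] (x y : Bulk p) : ℝ :=
  x.depth + y.depth -
    2 * sSup (Bulk.depth ''
      {j : Bulk p | (W.bulk x).OnPathToBdry (W.bulk j) ∧ (W.bulk y).OnPathToBdry (W.bulk j)})

end PadicBulk

end

noncomputable section

namespace PadicBulk

variable {p : ℕ} [Fact p.Prime]

/-! ### The value group of `ℂ_[p]` -/

/-! By the ultrametric inequality, chordal distance at most 1 means that two pairs `(z₀, z)` define
the same disk around `z` of radius `‖z₀‖`. So bulk points are the disks with radius in the value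
group, which is `p ^ ℚ`, and boundary points of infinite depth are disks of radius 0.

Order and topology on both sides are read off from one function, `gauge x : b ↦ |T - b|_x`, which is
`max r ‖a - b‖` for the disk `(a, r)` and `⊤` at infinity. As `ℂ_[p]` is algebraically closed, the
values on linear polynomials determine a multiplicative seminorm, and `gauge` embeds the Berkovich
line into a product of copies of `EReal` (`isClosedEmbedding_gauge`). Disk inclusion
(`IsDiskOf.subset_iff_gauge_le`) and descent in the tree (`W.onPathToBdry_iff_gauge_le`) are both
the pointwise order of gauges. The tree topology is also induced by the gauges
(`W.isInducing_gauge_toBerk`): cutting `W` at the disk `(b, ‖d‖)` gives the sets where the gauge at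
`b` is above or below `‖d‖`.

For the metrics, the deepest common ancestor of two disks is the smallest disk containing both
(`Bulk.pathDist_mk_mk`). -/

theorem norm_natCast_self : ‖(p : ℂ_[p])‖ = (p : ℝ)⁻¹ := by
  rw [← map_natCast (algebraMap ℚ_[p] ℂ_[p]), norm_algebraMap', Padic.norm_p]

theorem one_lt_prime : (1 : ℝ) < p := by
  exact_mod_cast (Fact.out : p.Prime).one_lt

/-- The constant coefficient is, up to sign, the product of the conjugates of `x`. These share its
norm, because the spectral norm depends only on the minimal polynomial. -/
theorem norm_pow_natDegree_minpoly (x : PadicAlgCl p) :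
    ‖x‖ ^ (minpoly ℚ_[p] x).natDegree = ‖(minpoly ℚ_[p] x).coeff 0‖ := by
  have hx : IsIntegral ℚ_[p] x := Algebra.IsIntegral.isIntegral x
  set P := minpoly ℚ_[p] x with hP
  set Q := P.map (algebraMap ℚ_[p] (PadicAlgCl p)) with hQ
  have hQm : Q.Monic := (minpoly.monic hx).map _
  have hQs : Q.Splits := IsAlgClosed.splits Q
  have hroot : ∀ y ∈ Q.roots, ‖y‖ = ‖x‖ := by
    intro y hy
    have h1 : Polynomial.aeval y P = 0 := by
      have := (Polynomial.mem_roots'.1 hy).2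
      rwa [Polynomial.IsRoot, hQ, Polynomial.eval_map_algebraMap] at this
    have h2 : P = minpoly ℚ_[p] y :=
      minpoly.eq_of_irreducible_of_monic (minpoly.irreducible hx) h1 (minpoly.monic hx)
    rw [← PadicAlgCl.spectralNorm_eq, ← PadicAlgCl.spectralNorm_eq, spectralNorm, spectralNorm,
      ← h2]
  have h0 := congrArg norm (hQs.coeff_zero_eq_prod_roots_of_monic hQm)
  have h3 : ‖Q.roots.prod‖ = ‖x‖ ^ Q.roots.card := by
    rw [← normHom_apply, map_multiset_prod, Multiset.map_congr rfl (g := fun _ => ‖x‖)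
      (fun y hy => by simpa using hroot y hy), Multiset.map_const', Multiset.prod_replicate]
  rw [norm_mul, norm_pow, norm_neg, norm_one, one_pow, one_mul, h3, ← hQs.natDegree_eq_card_roots,
    hQ, Polynomial.natDegree_map, Polynomial.coeff_map, norm_algebraMap'] at h0
  exact h0.symm

theorem PadicAlgCl.exists_norm_eq_rpow {x : PadicAlgCl p} (hx : x ≠ 0) :
    ∃ i : ℚ, ‖x‖ = (p : ℝ) ^ (i : ℝ) := by
  have hi : IsIntegral ℚ_[p] x := Algebra.IsIntegral.isIntegral x
  have hn := (minpoly.natDegree_pos hi).ne'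
  have h := norm_pow_natDegree_minpoly x
  rw [Padic.norm_eq_zpow_neg_valuation (minpoly.coeff_zero_ne_zero hi hx)] at h
  refine ⟨(-((minpoly ℚ_[p] x).coeff 0).valuation : ℤ) / ((minpoly ℚ_[p] x).natDegree : ℚ), ?_⟩
  rw [← Real.pow_rpow_inv_natCast (norm_nonneg x) hn, h, ← Real.rpow_intCast,
    ← Real.rpow_mul (by positivity)]
  push_cast
  rfl

/-- Completion adds no new norms: an algebraic `y` closer to `x` than `‖x‖` satisfies `‖y‖ = ‖x‖`.
-/
theorem exists_norm_eq_rpow {x : ℂ_[p]} (hx : x ≠ 0) : ∃ i : ℚ, ‖x‖ = (p : ℝ) ^ (i : ℝ) := by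
  obtain ⟨y, hy⟩ := (UniformSpace.Completion.denseRange_coe (α := PadicAlgCl p)).exists_dist_lt x
    (norm_pos_iff.2 hx)
  have hxy : ‖(y : ℂ_[p])‖ = ‖x‖ := by
    rw [dist_comm, dist_eq_norm] at hy
    by_contra hne
    have h1 := IsUltrametricDist.norm_add_eq_max_of_norm_ne_norm
      (x := (y : ℂ_[p])) (y := -x) (by rwa [norm_neg])
    rw [← sub_eq_add_neg, norm_neg] at h1
    exact absurd (h1 ▸ le_max_right _ _) (not_le.2 hy)
  rw [← hxy, PadicComplex.norm_extends]
  refine PadicAlgCl.exists_norm_eq_rpow ?_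
  rintro rfl
  rw [PadicComplex.coe_zero, norm_zero] at hxy
  exact hx (norm_eq_zero.1 hxy.symm)

theorem exists_isRatPow (ω : ℚ) : ∃ z₀ : ℂ_[p]ˣ, IsRatPow z₀ ω := by
  have hp0 : (p : ℂ_[p]) ≠ 0 := Nat.cast_ne_zero.2 (Fact.out : p.Prime).ne_zero
  obtain ⟨z, hz⟩ := IsAlgClosed.exists_pow_nat_eq ((p : ℂ_[p]) ^ ω.num) ω.pos
  refine ⟨Units.mk0 z ?_, hz⟩
  rintro rfl
  rw [zero_pow ω.den_nz] at hz
  exact zpow_ne_zero _ hp0 hz.symm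

theorem IsRatPow.norm_eq {z₀ : ℂ_[p]ˣ} {ω : ℚ} (h : IsRatPow z₀ ω) :
    ‖(z₀ : ℂ_[p])‖ = (p : ℝ) ^ (-(ω : ℝ)) := by
  have h1 := congrArg norm h
  rw [norm_pow, norm_zpow, norm_natCast_self, inv_zpow', ← Real.rpow_intCast] at h1
  rw [← Real.pow_rpow_inv_natCast (norm_nonneg _) ω.den_nz, h1, ← Real.rpow_mul (by positivity)]
  congr 1
  rw [Rat.cast_def ω]
  push_cast
  ring

theorem exists_norm_between {a b : ℝ} (ha : 0 ≤ a) (hab : a < b) :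
    ∃ c : ℂ_[p], c ≠ 0 ∧ a < ‖c‖ ∧ ‖c‖ < b := by
  have hp := one_lt_prime (p := p)
  obtain ⟨a', ha', hab'⟩ := exists_between hab
  have ha0 : 0 < a' := ha.trans_lt ha'
  obtain ⟨q, h1, h2⟩ := exists_rat_btwn (Real.logb_lt_logb hp ha0 hab')
  obtain ⟨z, hz⟩ := exists_isRatPow (p := p) (-q)
  refine ⟨z, z.ne_zero, ?_, ?_⟩
  · rw [hz.norm_eq, Rat.cast_neg, neg_neg]
    exact ha'.trans ((Real.logb_lt_iff_lt_rpow hp ha0).1 h1)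
  · rw [hz.norm_eq, Rat.cast_neg, neg_neg]
    exact (Real.lt_logb_iff_rpow_lt hp (ha0.trans hab')).1 h2

/-! ### Generic points of disks -/

theorem norm_sub_le_max (x y : ℂ_[p]) : ‖x - y‖ ≤ max ‖x‖ ‖y‖ := by
  simpa [sub_eq_add_neg] using IsUltrametricDist.norm_add_le_max x (-y)

theorem norm_sub_le_max_sub (x y z : ℂ_[p]) : ‖x - z‖ ≤ max ‖x - y‖ ‖y - z‖ := by
  simpa using IsUltrametricDist.norm_add_le_max (x - y) (y - z)

/-- The residue field of `ℂ_[p]` is infinite. -/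
theorem exists_finset_pairwise_norm_sub_eq_one (n : ℕ) :
    ∃ S : Finset ℂ_[p], n ≤ S.card ∧ (∀ x ∈ S, ‖x‖ = 1) ∧
      ∀ x ∈ S, ∀ y ∈ S, x ≠ y → ‖x - y‖ = 1 := by
  classical
  have hpp : p.Prime := Fact.out
  -- The order `p * n + 1` is prime to `p`. The product of the `1 - ζ ^ k` with `0 < k < p * n + 1`
  -- is `p * n + 1`, of norm 1; no factor exceeds norm 1, so each has norm exactly 1.
  obtain ⟨ζ, hζ⟩ := HasEnoughRootsOfUnity.exists_primitiveRoot ℂ_[p] (p * n + 1)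
  have hζ1 : ‖ζ‖ = 1 := by
    refine (pow_eq_one_iff_of_nonneg (norm_nonneg ζ) (Nat.succ_ne_zero (p * n))).1 ?_
    rw [← norm_pow, hζ.pow_eq_one, norm_one]
  have hle : ∀ k : ℕ, ‖1 - ζ ^ (k + 1)‖ ≤ 1 := fun k =>
    (norm_sub_le_max _ _).trans (by simp [hζ1])
  have hprod := congrArg norm hζ.prod_one_sub_pow_eq_order
  have hnorm : ‖((p * n : ℕ) : ℂ_[p]) + 1‖ = 1 := by
    have h1 : ‖((p * n : ℕ) : ℂ_[p])‖ < 1 := by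
      push_cast
      rw [norm_mul, norm_natCast_self]
      have h2 : ‖(n : ℂ_[p])‖ ≤ 1 := IsUltrametricDist.norm_natCast_le_one ℂ_[p] n
      have h3 : (p : ℝ)⁻¹ < 1 := inv_lt_one_of_one_lt₀ one_lt_prime
      have h4 : 0 ≤ (p : ℝ)⁻¹ := by positivity
      nlinarith
    have := IsUltrametricDist.norm_add_eq_max_of_norm_ne_norm
      (x := ((p * n : ℕ) : ℂ_[p])) (y := 1) (by rw [norm_one]; exact h1.ne)
    rw [this, norm_one, max_eq_right h1.le]
  rw [hnorm, norm_prod] at hprod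
  have hone : ∀ k < p * n, ‖1 - ζ ^ (k + 1)‖ = 1 := by
    intro k hk
    refine le_antisymm (hle k) ?_
    rw [← hprod, ← Finset.mul_prod_erase _ _ (Finset.mem_range.2 hk)]
    exact mul_le_of_le_one_right (norm_nonneg _)
      (Finset.prod_le_one (fun _ _ => norm_nonneg _) fun i _ => hle i)
  have hlt : ∀ i j, i < j → j < p * n + 1 → ‖ζ ^ i - ζ ^ j‖ = 1 := by
    intro i j hij hj
    obtain ⟨k, rfl⟩ := Nat.exists_eq_add_of_lt hij
    rw [show ζ ^ i - ζ ^ (i + k + 1) = ζ ^ i * (1 - ζ ^ (k + 1)) by ring, norm_mul, norm_pow, hζ1,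
      one_pow, one_mul, hone k (by omega)]
  refine ⟨(Finset.range (p * n + 1)).image (ζ ^ ·), ?_, ?_, ?_⟩
  · rw [Finset.card_image_of_injOn, Finset.card_range]
    · nlinarith [hpp.one_lt]
    · exact fun i hi j hj h => hζ.pow_inj (Finset.mem_range.1 hi) (Finset.mem_range.1 hj) h
  · simp [hζ1]
  · simp only [Finset.mem_image, Finset.mem_range]
    rintro _ ⟨i, hi, rfl⟩ _ ⟨j, hj, rfl⟩ hne
    rcases lt_trichotomy i j with h | rfl | h
    · exact hlt i j h hj
    · exact absurd rfl hne
    · rw [norm_sub_rev]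
      exact hlt j i h hi

/-- A disk contains a point that is as far as possible from finitely many given points. -/
theorem exists_generic (a c : ℂ_[p]) (T : Finset ℂ_[p]) :
    ∃ z, ‖z - a‖ ≤ ‖c‖ ∧ ∀ b ∈ T, ‖z - b‖ = max ‖c‖ ‖a - b‖ := by
  classical
  obtain ⟨S, hcard, hS1, hS⟩ := exists_finset_pairwise_norm_sub_eq_one (p := p) (T.card + 1)
  by_contra! hcon
  have hcS : ∀ x ∈ S, ‖c * x‖ = ‖c‖ := fun x hx => by rw [norm_mul, hS1 x hx, mul_one]
  have hbad : ∀ x ∈ S, ∃ b ∈ T, ‖a + c * x - b‖ < max ‖c‖ ‖a - b‖ := by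
    intro x hx
    obtain ⟨b, hb, hne⟩ := hcon (a + c * x) (by simp [hS1 x hx])
    refine ⟨b, hb, lt_of_le_of_ne ?_ hne⟩
    have := IsUltrametricDist.norm_add_le_max (c * x) (a - b)
    rwa [hcS x hx, show c * x + (a - b) = a + c * x - b by ring] at this
  choose! f hfT hf using hbad
  -- Pigeonhole: two candidates `a + c * x`, `a + c * y` are too close to the same `b`. They are
  -- `‖c‖` apart, which forces `‖c‖ < ‖a - b‖`; but then `a + c * x` is at distance exactly `‖a -
  -- b‖` from `b`.
  obtain ⟨x, hx, y, hy, hxy, hfxy⟩ :=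
    Finset.exists_ne_map_eq_of_card_lt_of_maps_to (Nat.lt_of_succ_le hcard) hfT
  have h1 := hf x hx
  have h2 := hf y hy
  rw [← hfxy] at h2
  have h3 : ‖c‖ < max ‖c‖ ‖a - f x‖ := by
    calc ‖c‖ = ‖(a + c * x - f x) - (a + c * y - f x)‖ := by
          rw [show (a + c * x - f x) - (a + c * y - f x) = c * (x - y) by ring, norm_mul,
            hS x hx y hy hxy, mul_one]
      _ ≤ _ := norm_sub_le_max _ _
      _ < _ := max_lt h1 h2
  have h4 : ‖c‖ < ‖a - f x‖ := by simpa using h3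
  have h5 := IsUltrametricDist.norm_add_eq_max_of_norm_ne_norm (x := c * x) (y := a - f x)
    (by rw [hcS x hx]; exact h4.ne)
  rw [hcS x hx, show c * x + (a - f x) = a + c * x - f x by ring] at h5
  exact h1.ne h5

/-! ### The points of disks -/

/-- The supremum norm on the closed disk around `a` of radius `‖c‖`. -/
def diskNorm (a c : ℂ_[p]) (f : ℂ_[p][X]) : ℝ :=
  ‖f.leadingCoeff‖ * (f.roots.map fun b => max ‖c‖ ‖a - b‖).prod

theorem norm_eval_eq (f : ℂ_[p][X]) (z : ℂ_[p]) :
    ‖f.eval z‖ = ‖f.leadingCoeff‖ * (f.roots.map fun b => ‖z - b‖).prod := by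
  rw [(IsAlgClosed.splits f).eval_eq_prod_roots, norm_mul, ← normHom_apply (Multiset.prod _),
    map_multiset_prod, Multiset.map_map]
  rfl

theorem norm_eval_le_diskNorm {a c z : ℂ_[p]} (hz : ‖z - a‖ ≤ ‖c‖) (f : ℂ_[p][X]) :
    ‖f.eval z‖ ≤ diskNorm a c f := by
  rw [norm_eval_eq, diskNorm]
  refine mul_le_mul_of_nonneg_left ?_ (norm_nonneg _)
  exact Multiset.prod_map_le_prod_map₀ _ _ (fun _ _ => norm_nonneg _)
    fun b _ => (norm_sub_le_max_sub z a b).trans (max_le_max_right _ hz)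

/-- A point generic with respect to the roots of `f` maximizes all linear factors at once. -/
theorem exists_norm_eval_eq_diskNorm (a c : ℂ_[p]) (f : ℂ_[p][X]) :
    ∃ z, ‖z - a‖ ≤ ‖c‖ ∧ ‖f.eval z‖ = diskNorm a c f := by
  classical
  obtain ⟨z, hz, h⟩ := exists_generic a c f.roots.toFinset
  refine ⟨z, hz, ?_⟩
  rw [norm_eval_eq, diskNorm, Multiset.map_congr rfl fun b hb => h b (Multiset.mem_toFinset.2 hb)]

theorem diskNorm_C (a c d : ℂ_[p]) : diskNorm a c (Polynomial.C d) = ‖d‖ := by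
  simp [diskNorm]

theorem diskNorm_X_sub_C (a c b : ℂ_[p]) :
    diskNorm a c (Polynomial.X - Polynomial.C b) = max ‖c‖ ‖a - b‖ := by
  simp [diskNorm]

/-- The point of the closed disk around `a` of radius `‖c‖`. -/
def diskPoint (a c : ℂ_[p]) : BerkAffine p :=
  ⟨{ toFun := diskNorm a c
     map_zero' := by simp [diskNorm]
     add_le' := fun f g => by
      -- The supremum for `f + g` is attained, so the inequality reduces to one point `z`.
      obtain ⟨z, hz, h⟩ := exists_norm_eval_eq_diskNorm a c (f + g)
      rw [← h, Polynomial.eval_add]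
      exact (norm_add_le _ _).trans
        (add_le_add (norm_eval_le_diskNorm hz f) (norm_eval_le_diskNorm hz g))
     neg' := fun f => by simp [diskNorm, Polynomial.roots_neg]
     map_one' := by simpa using diskNorm_C a c 1
     map_mul' := fun f g => by
      by_cases h : f * g = 0
      · rcases mul_eq_zero.1 h with rfl | rfl <;> simp [diskNorm]
      · simp only [diskNorm, Polynomial.roots_mul h, Polynomial.leadingCoeff_mul, norm_mul,
          Multiset.map_add, Multiset.prod_add]
        ring },
    diskNorm_C a c⟩

theorem diskPoint_apply (a c : ℂ_[p]) (f : ℂ_[p][X]) : (diskPoint a c).1 f = diskNorm a c f := rfl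

theorem isLUB_diskNorm (a c : ℂ_[p]) (f : ℂ_[p][X]) :
    IsLUB ((fun z => ‖f.eval z‖) '' Metric.closedBall a ‖c‖) (diskNorm a c f) := by
  refine IsGreatest.isLUB ⟨?_, ?_⟩
  · obtain ⟨z, hz, h⟩ := exists_norm_eval_eq_diskNorm a c f
    exact ⟨z, by simpa [dist_eq_norm] using hz, h⟩
  · rintro _ ⟨z, hz, rfl⟩
    exact norm_eval_le_diskNorm (by simpa [dist_eq_norm] using hz) f

theorem isDiskPoint_diskPoint (a c : ℂ_[p]) : IsDiskPoint (diskPoint a c : BerkProj p) a ‖c‖ :=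
  ⟨_, rfl, isLUB_diskNorm a c⟩

theorem IsDiskPoint.eq_diskPoint {x : BerkProj p} {a c : ℂ_[p]} (h : IsDiskPoint x a ‖c‖) :
    x = diskPoint a c := by
  obtain ⟨y, rfl, hy⟩ := h
  congr 1
  refine Subtype.ext (DFunLike.ext _ _ fun f => ?_)
  exact (hy f).unique (isLUB_diskNorm a c f)

/-! ### The topology of the Berkovich projective line -/

open Polynomial (X C)

/-- Each seminorm axiom is a closed condition on finitely many coordinates. -/
theorem isClosed_range_eval :
    IsClosed (Set.range fun (x : BerkAffine p) (f : ℂ_[p][X]) => x.1 f) := by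
  have h : (Set.range fun (x : BerkAffine p) (f : ℂ_[p][X]) => x.1 f) =
      ({v | ∀ f g, v (f + g) ≤ v f + v g} ∩ {v | ∀ f g, v (f * g) = v f * v g} ∩
        {v | ∀ f, v (-f) = v f} ∩ {v | ∀ c, v (C c) = ‖c‖}) := by
    ext v
    constructor
    · rintro ⟨x, rfl⟩
      exact ⟨⟨⟨map_add_le_add x.1, map_mul x.1⟩, map_neg_eq_map x.1⟩, x.2⟩
    · rintro ⟨⟨⟨hadd, hmul⟩, hneg⟩, hC⟩
      exact ⟨⟨{ toFun := v
                map_zero' := by simpa using hC 0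
                add_le' := hadd
                neg' := hneg
                map_one' := by simpa using hC 1
                map_mul' := hmul }, hC⟩, rfl⟩
  rw [h]
  simp only [Set.ofPred_forall]
  refine ((IsClosed.inter ?_ ?_).inter ?_).inter ?_
  · exact isClosed_iInter fun f => isClosed_iInter fun g =>
      isClosed_le (by fun_prop) (by fun_prop)
  · exact isClosed_iInter fun f => isClosed_iInter fun g =>
      isClosed_eq (by fun_prop) (by fun_prop)
  · exact isClosed_iInter fun f => isClosed_eq (by fun_prop) (by fun_prop)
  · exact isClosed_iInter fun f => isClosed_eq (by fun_prop) (by fun_prop)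

theorem isClosedEmbedding_eval :
    Topology.IsClosedEmbedding fun (x : BerkAffine p) (f : ℂ_[p][X]) => x.1 f where
  eq_induced := rfl
  injective := fun _ _ h => Subtype.ext (DFunLike.coe_injective h)
  isClosed_range := isClosed_range_eval

theorem continuous_eval (f : ℂ_[p][X]) : Continuous fun x : BerkAffine p => x.1 f :=
  (continuous_apply f).comp isClosedEmbedding_eval.continuous

/-- A bound on `|T - b|` bounds every polynomial, which places the seminorms in a product of compact
intervals, where Tychonoff applies. -/
theorem exists_eval_le (b : ℂ_[p]) (R : ℝ) (f : ℂ_[p][X]) :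
    ∃ B : ℝ, ∀ x : BerkAffine p, x.1 (X - C b) ≤ R → x.1 f ≤ B := by
  induction f using Polynomial.induction_on with
  | C a => exact ⟨‖a‖, fun x _ => (x.2 a).le⟩
  | add f g hf hg =>
    obtain ⟨B, hB⟩ := hf
    obtain ⟨D, hD⟩ := hg
    exact ⟨B + D, fun x hx => (map_add_le_add x.1 f g).trans (add_le_add (hB x hx) (hD x hx))⟩
  | monomial n a hf =>
    obtain ⟨B, hB⟩ := hf
    refine ⟨B * (R + ‖b‖), fun x hx => ?_⟩
    rw [pow_succ, ← mul_assoc, map_mul]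
    refine mul_le_mul (hB x hx) ?_ (apply_nonneg _ _) ((apply_nonneg _ _).trans (hB x hx))
    calc x.1 X = x.1 ((X - C b) + C b) := by rw [sub_add_cancel]
      _ ≤ _ := map_add_le_add _ _ _
      _ ≤ _ := add_le_add hx (x.2 b).le

theorem isCompact_setOf_eval_le (b : ℂ_[p]) (R : ℝ) :
    IsCompact {x : BerkAffine p | x.1 (X - C b) ≤ R} := by
  choose B hB using exists_eval_le (p := p) b R
  refine (isClosedEmbedding_eval.isCompact_preimage
    (isCompact_univ_pi fun f => isCompact_Icc (a := 0) (b := B f))).of_isClosed_subset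
    (isClosed_le (continuous_eval _) continuous_const) ?_
  exact fun x hx f _ => ⟨apply_nonneg _ _, hB f x hx⟩

/-- The values `|T - b|_x`, which are infinite at the point at infinity. -/
def gauge (x : BerkProj p) (b : ℂ_[p]) : EReal :=
  x.elim ⊤ fun y : BerkAffine p => ((y.1 (X - C b) : ℝ) : EReal)

theorem gauge_infty (b : ℂ_[p]) : gauge (∞ : BerkProj p) b = ⊤ := rfl

theorem gauge_coe (y : BerkAffine p) (b : ℂ_[p]) :
    gauge (y : BerkProj p) b = ((y.1 (X - C b) : ℝ) : EReal) := rfl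

theorem gauge_diskPoint (a c b : ℂ_[p]) :
    gauge (diskPoint a c : BerkProj p) b = ((max ‖c‖ ‖a - b‖ : ℝ) : EReal) := by
  rw [gauge_coe, diskPoint_apply, diskNorm_X_sub_C]

/-- At infinity this is the compactness of the sets `|T - b| ≤ R`. -/
theorem continuous_gauge : Continuous (gauge : BerkProj p → ℂ_[p] → EReal) := by
  refine continuous_pi fun b => (OnePoint.continuous_iff _).2 ⟨?_, ?_⟩
  · refine EReal.tendsto_nhds_top_iff_real.2 fun R => ?_
    filter_upwards [(isCompact_setOf_eval_le b R).compl_mem_coclosedCompact_of_isClosed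
      (isClosed_le (continuous_eval _) continuous_const)] with x hx
    exact EReal.coe_lt_coe_iff.2 (not_le.1 hx)
  · exact continuous_coe_real_ereal.comp (continuous_eval _)

theorem BerkAffine.ext_of_eval_X_sub_C {x y : BerkAffine p}
    (h : ∀ b, x.1 (X - C b) = y.1 (X - C b)) : x = y := by
  refine Subtype.ext (DFunLike.ext _ _ fun f => ?_)
  rw [(IsAlgClosed.splits f).eq_prod_roots, map_mul, map_mul, x.2, y.2, map_multiset_prod,
    map_multiset_prod, Multiset.map_map, Multiset.map_map]
  simp only [Function.comp_def, h]

theorem gauge_injective : Function.Injective (gauge : BerkProj p → ℂ_[p] → EReal) := by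
  intro x y h
  induction x using OnePoint.rec with
  | infty =>
    induction y using OnePoint.rec with
    | infty => rfl
    | coe y => exact absurd (congrFun h 0).symm (EReal.coe_ne_top _)
  | coe x =>
    induction y using OnePoint.rec with
    | infty => exact absurd (congrFun h 0) (EReal.coe_ne_top _)
    | coe y =>
      exact congrArg _ (BerkAffine.ext_of_eval_X_sub_C fun b => EReal.coe_injective (congrFun h b))

/-- A continuous injection from a compact space to a Hausdorff space. -/
theorem isClosedEmbedding_gauge :
    Topology.IsClosedEmbedding (gauge : BerkProj p → ℂ_[p] → EReal) :=
  continuous_gauge.isClosedEmbedding gauge_injective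

/-! ### Disks with arbitrary real radii -/

/-- For `r < 0` the ball is empty, and the empty set has no least upper bound in `ℝ`. -/
theorem IsDiskPoint.nonneg {x : BerkProj p} {a : ℂ_[p]} {r : ℝ} (h : IsDiskPoint x a r) :
    0 ≤ r := by
  obtain ⟨y, -, hy⟩ := h
  by_contra! hr
  have := hy 0
  rw [Metric.closedBall_eq_empty.2 hr, Set.image_empty, isLUB_empty_iff] at this
  exact (sub_one_lt (y.1 0)).not_ge (this _)

/-- Here `r` need not be a norm; density of the value group supplies points of the disk whose
distance to `a` is as near to `r` as needed. -/
theorem IsDiskPoint.gauge_eq {x : BerkProj p} {a : ℂ_[p]} {r : ℝ} (h : IsDiskPoint x a r)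
    (b : ℂ_[p]) : gauge x b = ((max r ‖a - b‖ : ℝ) : EReal) := by
  have hr := h.nonneg
  obtain ⟨y, rfl, hy⟩ := h
  rw [gauge_coe]
  congr 1
  refine (hy (X - C b)).unique ⟨?_, fun u hu => ?_⟩
  · rintro _ ⟨z, hz, rfl⟩
    have hz' : ‖z - a‖ ≤ r := by simpa [dist_eq_norm] using hz
    simpa using (norm_sub_le_max_sub z a b).trans (max_le_max_right _ hz')
  · have hu' : ∀ z, ‖z - a‖ ≤ r → ‖z - b‖ ≤ u := fun z hz => by
      simpa using hu ⟨z, by simpa [dist_eq_norm] using hz, rfl⟩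
    have hab := hu' a (by simpa using hr)
    refine max_le ?_ hab
    by_contra! hur
    obtain ⟨c, -, hc1, hc2⟩ := exists_norm_between (p := p) ((norm_nonneg _).trans hab) hur
    have h1 := hu' (a + c) (by simpa using hc2.le)
    have h2 := norm_sub_le_max (a + c - b) (a - b)
    rw [show a + c - b - (a - b) = c by ring] at h2
    exact hc1.not_ge (h2.trans (max_le h1 hab))

theorem IsDiskPoint.radius_eq_and_norm_sub_le {x : BerkProj p} {a b : ℂ_[p]} {r s : ℝ}
    (h : IsDiskPoint x a r) (h' : IsDiskPoint x b s) : r = s ∧ ‖a - b‖ ≤ s := by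
  have key : ∀ {a b : ℂ_[p]} {r s : ℝ}, IsDiskPoint x a r → IsDiskPoint x b s →
      s = max r ‖a - b‖ := by
    intro a b r s h h'
    have h1 := EReal.coe_injective ((h.gauge_eq b).symm.trans (h'.gauge_eq b))
    rw [sub_self, norm_zero, max_eq_left h'.nonneg] at h1
    exact h1.symm
  have h1 := key h h'
  have h2 := key h' h
  have h3 := h1 ▸ le_max_left r ‖a - b‖
  have h4 := h2 ▸ le_max_left s ‖b - a‖
  exact ⟨le_antisymm h3 h4, h1 ▸ le_max_right r ‖a - b‖⟩

/-! ### The points of `W` as disks -/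

theorem Bulk.mk_eq_mk_iff {z₀ w₀ : ℂ_[p]ˣ} {z w : ℂ_[p]} :
    Bulk.mk z₀ z = Bulk.mk w₀ w ↔
      ‖(z₀ : ℂ_[p])‖ = ‖(w₀ : ℂ_[p])‖ ∧ ‖z - w‖ ≤ ‖(z₀ : ℂ_[p])‖ :=
  Quotient.eq.trans (chordalDist_le_one_iff _ _)

theorem Bulk.exists_eq_mk (q : Bulk p) : ∃ z₀ z, q = Bulk.mk z₀ z := by
  obtain ⟨⟨z₀, z⟩, rfl⟩ := Quotient.exists_rep q
  exact ⟨z₀, z, rfl⟩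

theorem Bulk.depth_mk (z₀ : ℂ_[p]ˣ) (z : ℂ_[p]) :
    (Bulk.mk z₀ z).depth = -Real.logb p ‖(z₀ : ℂ_[p])‖ := rfl

theorem Bulk.depth_mk_le_iff {z₀ w₀ : ℂ_[p]ˣ} {z w : ℂ_[p]} :
    (Bulk.mk w₀ w).depth ≤ (Bulk.mk z₀ z).depth ↔ ‖(z₀ : ℂ_[p])‖ ≤ ‖(w₀ : ℂ_[p])‖ := by
  rw [depth_mk, depth_mk, neg_le_neg_iff,
    Real.logb_le_logb one_lt_prime (norm_pos_iff.2 z₀.ne_zero) (norm_pos_iff.2 w₀.ne_zero)]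

theorem W.onBranch_bulk_mk {z₀ : ℂ_[p]ˣ} {z w : ℂ_[p]} :
    (W.bulk (Bulk.mk z₀ z)).OnBranch w ↔ ‖z - w‖ ≤ ‖(z₀ : ℂ_[p])‖ := by
  constructor
  · rintro ⟨w₀, h⟩
    exact (Bulk.mk_eq_mk_iff.1 h).2
  · exact fun h => ⟨z₀, Bulk.mk_eq_mk_iff.2 ⟨rfl, h⟩⟩

open Classical in
/-- The point of `W` that corresponds to the closed disk around `a` of radius `‖c‖`. -/
def W.ofDisk (a c : ℂ_[p]) : W p :=
  if h : c = 0 then .bdry a else .bulk (Bulk.mk (Units.mk0 c h) a)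

theorem W.ofDisk_zero (a : ℂ_[p]) : W.ofDisk a 0 = .bdry a := dif_pos rfl

theorem W.ofDisk_unit (a : ℂ_[p]) (c : ℂ_[p]ˣ) : W.ofDisk a c = .bulk (Bulk.mk c a) := by
  rw [ofDisk, dif_neg c.ne_zero, Units.mk0_val]

theorem W.eq_root_or_eq_ofDisk (x : W p) : x = .root ∨ ∃ a c, x = W.ofDisk a c := by
  cases x with
  | bulk q =>
    obtain ⟨z₀, z, rfl⟩ := q.exists_eq_mk
    exact Or.inr ⟨z, z₀, (ofDisk_unit z z₀).symm⟩
  | bdry z => exact Or.inr ⟨z, 0, (ofDisk_zero z).symm⟩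
  | root => exact Or.inl rfl

theorem W.ofDisk_ne_root (a c : ℂ_[p]) : W.ofDisk a c ≠ .root := by
  unfold ofDisk
  split_ifs <;> exact fun h => nomatch h

theorem W.ofDisk_onBranch_iff {a c w : ℂ_[p]} : (W.ofDisk a c).OnBranch w ↔ ‖a - w‖ ≤ ‖c‖ := by
  by_cases h : c = 0
  · subst h
    rw [ofDisk_zero, norm_zero, norm_le_zero_iff, sub_eq_zero]
    rfl
  · lift c to ℂ_[p]ˣ using IsUnit.mk0 c h
    rw [ofDisk_unit, onBranch_bulk_mk]

theorem W.depth_ofDisk_le_iff {a c b d : ℂ_[p]} :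
    (W.ofDisk b d).depth ≤ (W.ofDisk a c).depth ↔ ‖c‖ ≤ ‖d‖ := by
  by_cases hc : c = 0
  · subst hc
    simp [ofDisk_zero, depth]
  lift c to ℂ_[p]ˣ using IsUnit.mk0 c hc
  by_cases hd : d = 0
  · subst hd
    simp [ofDisk_zero, ofDisk_unit, depth]
  lift d to ℂ_[p]ˣ using IsUnit.mk0 d hd
  rw [ofDisk_unit, ofDisk_unit, depth, depth, EReal.coe_le_coe_iff, Bulk.depth_mk_le_iff]

theorem W.ofDisk_onPathToBdry_iff {a c b d : ℂ_[p]} :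
    (W.ofDisk a c).OnPathToBdry (W.ofDisk b d) ↔ ‖c‖ ≤ ‖d‖ ∧ ‖a - b‖ ≤ ‖d‖ := by
  rw [OnPathToBdry, depth_ofDisk_le_iff]
  refine and_congr_right fun hcd => ?_
  simp only [ofDisk_onBranch_iff]
  constructor
  · rintro ⟨w, hw, hw'⟩
    rw [norm_sub_rev] at hw'
    exact (norm_sub_le_max_sub a w b).trans (max_le (hw.trans hcd) hw')
  · exact fun h => ⟨a, by simp, by rwa [norm_sub_rev]⟩

theorem W.onPathToBdry_root (x : W p) : x.OnPathToBdry .root := by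
  refine ⟨bot_le, ?_⟩
  rcases x.eq_root_or_eq_ofDisk with rfl | ⟨a, c, rfl⟩
  · exact ⟨0, trivial, trivial⟩
  · exact ⟨a, ofDisk_onBranch_iff.2 (by simp), trivial⟩

theorem W.root_onPathToBdry_iff {x : W p} : W.root.OnPathToBdry x ↔ x = .root := by
  refine ⟨fun h => ?_, by rintro rfl; exact onPathToBdry_root _⟩
  have h1 : x.depth = ⊥ := le_bot_iff.1 h.1
  cases x with
  | bulk q => exact absurd h1 (EReal.coe_ne_bot _)
  | bdry z => exact absurd h1 (by simp [depth])
  | root => rfl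

/-! ### From `W` to the Berkovich projective line -/

theorem diskPoint_eq_of_norm {a c b d : ℂ_[p]} (h : ‖c‖ = ‖d‖) (h' : ‖a - b‖ ≤ ‖c‖) :
    diskPoint a c = diskPoint b d := by
  refine BerkAffine.ext_of_eval_X_sub_C fun w => ?_
  rw [diskPoint_apply, diskPoint_apply, diskNorm_X_sub_C, diskNorm_X_sub_C, ← h]
  refine le_antisymm (max_le (le_max_left _ _) ?_) (max_le (le_max_left _ _) ?_)
  · exact (norm_sub_le_max_sub a b w).trans (max_le_max_right _ h')
  · exact (norm_sub_le_max_sub b a w).trans (max_le_max_right _ (by rwa [norm_sub_rev]))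

/-- The point of a type II disk. -/
def Bulk.toBerk : Bulk p → BerkAffine p :=
  Quotient.lift (fun x => diskPoint x.2 x.1) fun x y h =>
    have h' := (chordalDist_le_one_iff x y).1 h
    diskPoint_eq_of_norm h'.1 h'.2

/-- The map from `W` to the Berkovich projective line. -/
def W.toBerk : W p → BerkProj p
  | .bulk q => (q.toBerk : BerkProj p)
  | .bdry z => (diskPoint z 0 : BerkProj p)
  | .root => ∞

theorem W.toBerk_ofDisk (a c : ℂ_[p]) : (W.ofDisk a c).toBerk = (diskPoint a c : BerkProj p) := by
  by_cases hc : c = 0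
  · subst hc
    rw [ofDisk_zero]
    rfl
  · lift c to ℂ_[p]ˣ using IsUnit.mk0 c hc
    rw [ofDisk_unit]
    rfl

theorem W.gauge_toBerk_ofDisk (a c b : ℂ_[p]) :
    gauge (W.ofDisk a c).toBerk b = ((max ‖c‖ ‖a - b‖ : ℝ) : EReal) := by
  rw [toBerk_ofDisk, gauge_diskPoint]

theorem W.gauge_toBerk_ofDisk_self (a c : ℂ_[p]) :
    gauge (W.ofDisk a c).toBerk a = ((‖c‖ : ℝ) : EReal) := by
  simp [gauge_toBerk_ofDisk]

theorem W.gauge_toBerk_root (b : ℂ_[p]) : gauge (W.root : W p).toBerk b = ⊤ := rfl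

theorem W.onPathToBdry_ofDisk_iff {x : W p} {b d : ℂ_[p]} :
    x.OnPathToBdry (W.ofDisk b d) ↔ gauge x.toBerk b ≤ ((‖d‖ : ℝ) : EReal) := by
  rcases x.eq_root_or_eq_ofDisk with rfl | ⟨a, c, rfl⟩
  · rw [root_onPathToBdry_iff, gauge_toBerk_root]
    simp [ofDisk_ne_root]
  · rw [ofDisk_onPathToBdry_iff, gauge_toBerk_ofDisk, EReal.coe_le_coe_iff, max_le_iff]

/-- The gauge of `x` at the centre of `y` already decides descent; the other values follow by the
ultrametric inequality. -/
theorem W.onPathToBdry_iff_gauge_le {x y : W p} :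
    x.OnPathToBdry y ↔ gauge x.toBerk ≤ gauge y.toBerk := by
  rcases y.eq_root_or_eq_ofDisk with rfl | ⟨b, d, rfl⟩
  · exact iff_of_true (onPathToBdry_root x) fun b => le_top
  · refine ⟨fun h w => ?_, fun h => onPathToBdry_ofDisk_iff.2
      ((h b).trans_eq (gauge_toBerk_ofDisk_self b d))⟩
    rcases x.eq_root_or_eq_ofDisk with rfl | ⟨a, c, rfl⟩
    · exact absurd (root_onPathToBdry_iff.1 h) (ofDisk_ne_root b d)
    · rw [ofDisk_onPathToBdry_iff] at h
      rw [gauge_toBerk_ofDisk, gauge_toBerk_ofDisk, EReal.coe_le_coe_iff]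
      refine max_le (h.1.trans (le_max_left _ _)) ?_
      exact (norm_sub_le_max_sub a b w).trans (max_le_max_right _ h.2)

theorem W.OnPathToBdry.trans {x y z : W p} (h : x.OnPathToBdry y) (h' : y.OnPathToBdry z) :
    x.OnPathToBdry z :=
  onPathToBdry_iff_gauge_le.2
    ((onPathToBdry_iff_gauge_le.1 h).trans (onPathToBdry_iff_gauge_le.1 h'))

theorem W.ofDisk_eq_ofDisk {a c b d : ℂ_[p]} (h : ‖c‖ = ‖d‖) (h' : ‖a - b‖ ≤ ‖c‖) :
    W.ofDisk a c = W.ofDisk b d := by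
  by_cases hc : c = 0
  · subst hc
    rw [norm_zero, eq_comm, norm_eq_zero] at h
    rw [norm_zero, norm_le_zero_iff, sub_eq_zero] at h'
    rw [h, h']
  · have hd : d ≠ 0 := by
      rintro rfl
      exact hc (norm_eq_zero.1 (h.trans norm_zero))
    lift c to ℂ_[p]ˣ using IsUnit.mk0 c hc
    lift d to ℂ_[p]ˣ using IsUnit.mk0 d hd
    rw [ofDisk_unit, ofDisk_unit, Bulk.mk_eq_mk_iff.2 ⟨h, h'⟩]

theorem W.toBerk_injective : Function.Injective (W.toBerk : W p → BerkProj p) := by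
  intro x y h
  have hxy : x.OnPathToBdry y := onPathToBdry_iff_gauge_le.2 (h ▸ le_rfl)
  have hyx : y.OnPathToBdry x := onPathToBdry_iff_gauge_le.2 (h ▸ le_rfl)
  rcases x.eq_root_or_eq_ofDisk with rfl | ⟨a, c, rfl⟩
  · exact (root_onPathToBdry_iff.1 hxy).symm
  rcases y.eq_root_or_eq_ofDisk with rfl | ⟨b, d, rfl⟩
  · exact root_onPathToBdry_iff.1 hyx
  rw [ofDisk_onPathToBdry_iff] at hxy hyx
  exact ofDisk_eq_ofDisk (le_antisymm hxy.1 hyx.1) (hxy.2.trans hyx.1)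

/-! ### The tree structure of `W` -/

/-- An ancestor of a disk around `a` is a disk around `a`. -/
theorem W.OnPathToBdry.eq_root_or_eq_ofDisk {a c : ℂ_[p]} {t : W p}
    (h : (W.ofDisk a c).OnPathToBdry t) : t = .root ∨ ∃ d, ‖c‖ ≤ ‖d‖ ∧ t = W.ofDisk a d := by
  refine t.eq_root_or_eq_ofDisk.imp_right ?_
  rintro ⟨b, d, rfl⟩
  rw [ofDisk_onPathToBdry_iff] at h
  exact ⟨d, h.1, ofDisk_eq_ofDisk rfl (by rw [norm_sub_rev]; exact h.2)⟩

/-- The ancestors of a disk around `a` are ordered by their radii. -/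
theorem W.OnPathToBdry.onPathToBdry_iff {a c : ℂ_[p]} {t u : W p}
    (hu : (W.ofDisk a c).OnPathToBdry u) :
    t.OnPathToBdry u ↔ gauge t.toBerk a ≤ gauge u.toBerk a := by
  rcases hu.eq_root_or_eq_ofDisk with rfl | ⟨d, -, rfl⟩
  · exact iff_of_true (onPathToBdry_root t) le_top
  · rw [onPathToBdry_ofDisk_iff, gauge_toBerk_ofDisk_self]

theorem W.OnPathToBdry.total {y t u : W p} (ht : y.OnPathToBdry t) (hu : y.OnPathToBdry u) :
    t.OnPathToBdry u ∨ u.OnPathToBdry t := by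
  rcases W.eq_root_or_eq_ofDisk y with rfl | ⟨a, c, rfl⟩
  · rw [root_onPathToBdry_iff.1 hu]
    exact Or.inl (onPathToBdry_root t)
  · rw [hu.onPathToBdry_iff, ht.onPathToBdry_iff]
    exact le_total _ _

/-- The radius of the smallest disk that contains two given disks is the norm of some element. -/
theorem exists_norm_eq_max (c d e : ℂ_[p]) : ∃ f : ℂ_[p], ‖f‖ = max (max ‖c‖ ‖d‖) ‖e‖ := by
  rcases max_choice (max ‖c‖ ‖d‖) ‖e‖ with h | h
  · rcases max_choice ‖c‖ ‖d‖ with h' | h'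
    · exact ⟨c, by rw [h, h']⟩
    · exact ⟨d, by rw [h, h']⟩
  · exact ⟨e, h.symm⟩

/-- If `t` is an ancestor of `y`, it is comparable with each common ancestor of `x` and `y`; none
can lie below `t`, since `x` does not. -/
theorem W.notMem_path_iff_of_not {x t : W p} (h : ¬ x.OnPathToBdry t) (y : W p) :
    t ∉ W.path x y ↔ ¬ y.OnPathToBdry t := by
  refine ⟨fun ht hy => ht ⟨Or.inr hy, fun u hxu hyu => ?_⟩, fun hy ht => ht.1.elim h hy⟩
  exact (hy.total hyu).resolve_right fun hut => h (hxu.trans hut)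

theorem W.notMem_path_iff {a c : ℂ_[p]} {t : W p} (h : (W.ofDisk a c).OnPathToBdry t) (y : W p) :
    t ∉ W.path (W.ofDisk a c) y ↔
      ((‖c‖ : ℝ) : EReal) < gauge t.toBerk a ∧ gauge y.toBerk a < gauge t.toBerk a := by
  have h1 : t ∉ W.path (W.ofDisk a c) y ↔
      ∃ u, (W.ofDisk a c).OnPathToBdry u ∧ y.OnPathToBdry u ∧ ¬ t.OnPathToBdry u := by
    constructor
    · intro ht
      by_contra! hcon
      exact ht ⟨Or.inl h, hcon⟩
    · rintro ⟨u, hxu, hyu, htu⟩ ht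
      exact htu (ht.2 u hxu hyu)
  rw [h1]
  constructor
  · rintro ⟨u, hxu, hyu, htu⟩
    rw [hxu.onPathToBdry_iff, not_le] at htu
    have hxa := onPathToBdry_iff_gauge_le.1 hxu a
    rw [gauge_toBerk_ofDisk_self] at hxa
    exact ⟨hxa.trans_lt htu, (onPathToBdry_iff_gauge_le.1 hyu a).trans_lt htu⟩
  · rintro ⟨hxt, hyt⟩
    rcases y.eq_root_or_eq_ofDisk with rfl | ⟨b, d, rfl⟩
    · rw [gauge_toBerk_root] at hyt
      exact absurd hyt not_top_lt
    -- The disk `(a, ‖e‖)` is the smallest one containing `x` and `y`; `t` is off the path because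
    -- this common ancestor lies strictly below it.
    obtain ⟨e, he⟩ := exists_norm_eq_max c d (b - a)
    have hu : (W.ofDisk a c).OnPathToBdry (W.ofDisk a e) := by
      rw [ofDisk_onPathToBdry_iff, sub_self, norm_zero, he]
      exact ⟨(le_max_left _ _).trans (le_max_left _ _), he ▸ norm_nonneg e⟩
    refine ⟨W.ofDisk a e, hu, ?_, ?_⟩
    · rw [ofDisk_onPathToBdry_iff, he]
      exact ⟨(le_max_right _ _).trans (le_max_left _ _), le_max_right _ _⟩
    · rw [hu.onPathToBdry_iff, not_le, gauge_toBerk_ofDisk_self, he, max_assoc,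
        EReal.coe_strictMono.monotone.map_max]
      rw [gauge_toBerk_ofDisk] at hyt
      exact max_lt hxt hyt

/-! ### The topology of `W` -/

theorem W.isOpen_setOf_notMem_path (t x : W p) : IsOpen {y | t ∉ W.path x y} :=
  TopologicalSpace.isOpen_generateFrom_of_mem ⟨t, x, rfl⟩

/-- This is the component of the root after the disk `(b, ‖d‖)` is removed. -/
theorem W.isOpen_setOf_norm_lt_gauge (b d : ℂ_[p]) :
    IsOpen {y : W p | ((‖d‖ : ℝ) : EReal) < gauge y.toBerk b} := by
  convert W.isOpen_setOf_notMem_path (W.ofDisk b d) .root using 3 with y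
  rw [notMem_path_iff_of_not fun h => ofDisk_ne_root b d (root_onPathToBdry_iff.1 h),
    onPathToBdry_ofDisk_iff, not_le]

/-- This is the component of the boundary point `b` after removal; `d ≠ 0` keeps that point distinct
from the removed one. -/
theorem W.isOpen_setOf_gauge_lt_norm (b : ℂ_[p]) {d : ℂ_[p]} (hd : d ≠ 0) :
    IsOpen {y : W p | gauge y.toBerk b < ((‖d‖ : ℝ) : EReal)} := by
  convert W.isOpen_setOf_notMem_path (W.ofDisk b d) (W.ofDisk b 0) using 3 with y
  rw [notMem_path_iff (ofDisk_onPathToBdry_iff.2 (by simp)), gauge_toBerk_ofDisk_self]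
  simp [hd]

theorem W.gauge_toBerk_nonneg (y : W p) (b : ℂ_[p]) : 0 ≤ gauge y.toBerk b := by
  rcases y.eq_root_or_eq_ofDisk with rfl | ⟨a, c, rfl⟩
  · exact le_top
  · rw [gauge_toBerk_ofDisk]
    exact_mod_cast (norm_nonneg c).trans (le_max_left _ _)

/-- The two preceding lemmas treat thresholds that are norms; these are dense among the nonnegative
reals. -/
theorem W.continuous_gauge_toBerk : Continuous fun y : W p => gauge y.toBerk := by
  refine continuous_pi fun b => OrderTopology.continuous_iff.2 fun r => ⟨?_, ?_⟩
  · refine isOpen_iff_forall_mem_open.2 fun y (hy : r < gauge y.toBerk b) => ?_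
    rcases lt_or_ge r 0 with hr | hr
    · exact ⟨Set.univ, fun z _ => hr.trans_le (gauge_toBerk_nonneg z b), isOpen_univ, trivial⟩
    obtain ⟨s, hs, hsy⟩ := EReal.lt_iff_exists_real_btwn.1 hy
    obtain ⟨s', hs', hsy'⟩ := EReal.lt_iff_exists_real_btwn.1 hsy
    have hs0 : 0 ≤ s := by exact_mod_cast hr.trans hs.le
    obtain ⟨c, -, h1, h2⟩ := exists_norm_between (p := p) hs0 (EReal.coe_lt_coe_iff.1 hs')
    refine ⟨_, fun z hz => ?_, isOpen_setOf_norm_lt_gauge b c,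
      (EReal.coe_lt_coe_iff.2 h2).trans hsy'⟩
    exact (hs.trans (EReal.coe_lt_coe_iff.2 h1)).trans hz
  · refine isOpen_iff_forall_mem_open.2 fun y (hy : gauge y.toBerk b < r) => ?_
    obtain ⟨s, hs, hsr⟩ := EReal.lt_iff_exists_real_btwn.1 hy
    obtain ⟨s', hs', hsr'⟩ := EReal.lt_iff_exists_real_btwn.1 hsr
    have hs0 : 0 ≤ s := by exact_mod_cast (gauge_toBerk_nonneg y b).trans hs.le
    obtain ⟨c, hc, h1, h2⟩ := exists_norm_between (p := p) hs0 (EReal.coe_lt_coe_iff.1 hs')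
    refine ⟨_, fun z (hz : gauge z.toBerk b < _) => ?_, isOpen_setOf_gauge_lt_norm b hc,
      hs.trans (EReal.coe_lt_coe_iff.2 h1)⟩
    exact (hz.trans (EReal.coe_lt_coe_iff.2 h2)).trans hsr'

theorem W.isInducing_gauge_toBerk : Topology.IsInducing fun y : W p => gauge y.toBerk := by
  refine ⟨le_antisymm continuous_gauge_toBerk.le_induced (le_generateFrom ?_)⟩
  let τ : TopologicalSpace (W p) := .induced (fun y : W p => gauge y.toBerk) inferInstance
  have hτ (b : ℂ_[p]) : @Continuous _ _ τ _ fun y : W p => gauge y.toBerk b :=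
    continuous_pi_iff.1 (continuous_induced_dom (f := fun y : W p => gauge y.toBerk)) b
  rintro _ ⟨t, x, rfl⟩
  by_cases h : x.OnPathToBdry t
  · rcases x.eq_root_or_eq_ofDisk with rfl | ⟨a, c, rfl⟩
    · obtain rfl := root_onPathToBdry_iff.1 h
      -- Every path from the root contains the root.
      have : {y : W p | W.root ∉ W.path .root y} = ∅ :=
        Set.eq_empty_iff_forall_notMem.2 fun y hy => hy ⟨Or.inl h, fun u hu _ => hu⟩
      rw [this]
      exact isOpen_empty
    · simp only [notMem_path_iff h]
      exact (isOpen_const (X := W p)).inter (isOpen_Iio.preimage (hτ a))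
  · rcases t.eq_root_or_eq_ofDisk with rfl | ⟨b, d, rfl⟩
    · exact absurd (onPathToBdry_root x) h
    · simp only [notMem_path_iff_of_not h, onPathToBdry_ofDisk_iff, not_le]
      exact isOpen_Ioi.preimage (hτ b)

theorem W.isInducing_toBerk : Topology.IsInducing (W.toBerk : W p → BerkProj p) :=
  isClosedEmbedding_gauge.isInducing.of_comp_iff.1 isInducing_gauge_toBerk

/-! ### The homeomorphisms -/

theorem Bulk.isTypeII_toBerk (q : Bulk p) : IsTypeII (q.toBerk : BerkProj p) := by
  obtain ⟨z₀, z, rfl⟩ := q.exists_eq_mk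
  exact ⟨z, z₀, isDiskPoint_diskPoint z z₀⟩

theorem W.isTypeI_or_isTypeII_toBerk (x : W p) : IsTypeI x.toBerk ∨ IsTypeII x.toBerk := by
  cases x with
  | bulk q => exact Or.inr q.isTypeII_toBerk
  | bdry z => exact Or.inl (Or.inr ⟨z, norm_zero (E := ℂ_[p]) ▸ isDiskPoint_diskPoint z 0⟩)
  | root => exact Or.inl (Or.inl rfl)

theorem IsDiskPoint.toBerk_ofDisk {x : BerkProj p} {a c : ℂ_[p]} (h : IsDiskPoint x a ‖c‖) :
    (W.ofDisk a c).toBerk = x := by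
  rw [W.toBerk_ofDisk, h.eq_diskPoint]

theorem IsDiskPoint.toBerk_bulk_mk {x : BerkProj p} {a : ℂ_[p]} {c : ℂ_[p]ˣ}
    (h : IsDiskPoint x a ‖(c : ℂ_[p])‖) : (W.bulk (Bulk.mk c a)).toBerk = x := by
  rw [← W.ofDisk_unit, h.toBerk_ofDisk]

theorem IsDiskPoint.toBerk_bdry {x : BerkProj p} {a : ℂ_[p]} (h : IsDiskPoint x a 0) :
    (W.bdry a).toBerk = x := by
  rw [← norm_zero (E := ℂ_[p])] at h
  rw [← W.ofDisk_zero, h.toBerk_ofDisk]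

/-- The homeomorphism from `W` to the set of type I and type II points. -/
def W.homeoTypeIOrII : W p ≃ₜ TypeIOrII p :=
  (Equiv.ofBijective (fun x : W p => (⟨x.toBerk, x.isTypeI_or_isTypeII_toBerk⟩ : TypeIOrII p))
    ⟨fun _ _ h => W.toBerk_injective (congrArg Subtype.val h), by
      rintro ⟨x, (rfl | ⟨a, h⟩) | ⟨a, c, h⟩⟩
      · exact ⟨.root, rfl⟩
      · exact ⟨.bdry a, Subtype.ext h.toBerk_bdry⟩
      · exact ⟨.bulk (Bulk.mk c a), Subtype.ext h.toBerk_bulk_mk⟩⟩).toHomeomorphOfIsInducing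
    (Topology.IsInducing.subtypeVal.of_comp_iff.1 W.isInducing_toBerk)

/-- The homeomorphism from the bulk of `W` to the set of type II points. -/
def Bulk.homeoHQ : Bulk p ≃ₜ HQ p :=
  (Equiv.ofBijective (fun q : Bulk p => (⟨q.toBerk, q.isTypeII_toBerk⟩ : HQ p))
    ⟨fun q q' h => W.bulk.inj (W.toBerk_injective
        (show (W.bulk q).toBerk = (W.bulk q').toBerk from congrArg Subtype.val h)), by
      rintro ⟨x, a, c, h⟩
      exact ⟨Bulk.mk c a, Subtype.ext h.toBerk_bulk_mk⟩⟩).toHomeomorphOfIsInducing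
    (Topology.IsInducing.subtypeVal.of_comp_iff.1 (W.isInducing_toBerk.comp (f := W.bulk) ⟨rfl⟩))

theorem W.coe_homeoTypeIOrII (x : W p) : (W.homeoTypeIOrII x).1 = x.toBerk := rfl

theorem W.toBerk_homeoTypeIOrII_symm (x : TypeIOrII p) :
    (W.homeoTypeIOrII.symm x).toBerk = x.1 :=
  congrArg Subtype.val (W.homeoTypeIOrII.apply_symm_apply x)

theorem Bulk.coe_homeoHQ (q : Bulk p) : (Bulk.homeoHQ q).1 = (W.bulk q).toBerk := rfl

theorem Bulk.homeoHQ_symm_eq_mk {x : HQ p} {a : ℂ_[p]} {c : ℂ_[p]ˣ}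
    (h : IsDiskPoint x.1 a ‖(c : ℂ_[p])‖) : Bulk.homeoHQ.symm x = Bulk.mk c a :=
  Bulk.homeoHQ.symm_apply_eq.2 (Subtype.ext h.toBerk_bulk_mk.symm)

/-- The radius is unique, so it is a norm in every presentation of a type II point. -/
theorem exists_bulk_mk_of_isDiskPoint (x : HQ p) {a : ℂ_[p]} {r : ℝ} (h : IsDiskPoint x.1 a r) :
    ∃ c : ℂ_[p]ˣ, r = ‖(c : ℂ_[p])‖ ∧ Bulk.homeoHQ.symm x = Bulk.mk c a := by
  obtain ⟨b, c, hbc⟩ := x.2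
  obtain ⟨rfl, -⟩ := h.radius_eq_and_norm_sub_le hbc
  exact ⟨c, rfl, Bulk.homeoHQ_symm_eq_mk h⟩

/-- Inclusion of disks is the pointwise order of the gauges. -/
theorem IsDiskOf.subset_iff_gauge_le {x y : BerkProj p} {B D : Set ℂ_[p]} (hB : IsDiskOf x B)
    (hD : IsDiskOf y D) : B ⊆ D ↔ gauge x ≤ gauge y := by
  rcases hD with ⟨rfl, rfl⟩ | ⟨b, s, hb, rfl⟩
  · exact iff_of_true (Set.subset_univ _) fun _ => le_top
  rcases hB with ⟨rfl, rfl⟩ | ⟨a, r, ha, rfl⟩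
  · refine iff_of_false (fun h => ?_) fun h => ?_
    · exact NormedSpace.unbounded_univ ℂ_[p] ℂ_[p] (Metric.isBounded_closedBall.subset h)
    · have := h b
      rw [gauge_infty, hb.gauge_eq] at this
      exact absurd (top_le_iff.1 this) (EReal.coe_ne_top _)
  constructor
  · intro h
    have hmem : ∀ z, ‖z - a‖ ≤ r → ‖z - b‖ ≤ s := fun z hz => by
      simpa [dist_eq_norm] using h (by simpa [dist_eq_norm] using hz : z ∈ Metric.closedBall a r)
    have hab : ‖a - b‖ ≤ s := hmem a (by simpa using ha.nonneg)
    have hrs : r ≤ s := by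
      by_contra! hsr
      obtain ⟨c, -, h1, h2⟩ := exists_norm_between (p := p) hb.nonneg hsr
      have h3 := norm_sub_le_max (a + c - b) (a - b)
      rw [show a + c - b - (a - b) = c by ring] at h3
      exact h1.not_ge (h3.trans (max_le (hmem (a + c) (by simpa using h2.le)) hab))
    intro w
    rw [ha.gauge_eq, hb.gauge_eq, EReal.coe_le_coe_iff]
    refine max_le (hrs.trans (le_max_left _ _)) ?_
    exact (norm_sub_le_max_sub a b w).trans (max_le_max_right _ hab)
  · intro h z hz
    have hab := h b
    rw [ha.gauge_eq, hb.gauge_eq, EReal.coe_le_coe_iff, sub_self, norm_zero,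
      max_eq_left hb.nonneg] at hab
    rw [mem_closedBall_iff_norm] at hz ⊢
    exact (norm_sub_le_max_sub z a b).trans ((max_le_max_right _ hz).trans hab)

/-! ### The path metric -/

theorem Bulk.pathDist_mk_mk (z₀ w₀ : ℂ_[p]ˣ) (z w : ℂ_[p]) :
    (Bulk.mk z₀ z).pathDist (Bulk.mk w₀ w) =
      2 * Real.logb p (max (max ‖(z₀ : ℂ_[p])‖ ‖(w₀ : ℂ_[p])‖) ‖z - w‖) -
        Real.logb p ‖(z₀ : ℂ_[p])‖ - Real.logb p ‖(w₀ : ℂ_[p])‖ := by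
  have hz₀ : 0 < ‖(z₀ : ℂ_[p])‖ := norm_pos_iff.2 z₀.ne_zero
  obtain ⟨e, he⟩ := exists_norm_eq_max (z₀ : ℂ_[p]) w₀ (z - w)
  have he0 : 0 < ‖e‖ := he ▸ hz₀.trans_le ((le_max_left _ _).trans (le_max_left _ _))
  lift e to ℂ_[p]ˣ using IsUnit.mk0 e (norm_pos_iff.1 he0)
  -- The supremum of depths is attained at the smallest disk containing both.
  have hsup : IsGreatest (Bulk.depth '' {j : Bulk p |
      (W.bulk (Bulk.mk z₀ z)).OnPathToBdry (W.bulk j) ∧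
        (W.bulk (Bulk.mk w₀ w)).OnPathToBdry (W.bulk j)}) (Bulk.mk e z).depth := by
    constructor
    · refine ⟨Bulk.mk e z, ⟨?_, ?_⟩, rfl⟩
      · rw [← W.ofDisk_unit, ← W.ofDisk_unit, W.ofDisk_onPathToBdry_iff, he]
        exact ⟨(le_max_left _ _).trans (le_max_left _ _), by simp⟩
      · rw [← W.ofDisk_unit, ← W.ofDisk_unit, W.ofDisk_onPathToBdry_iff, he, norm_sub_rev w z]
        exact ⟨(le_max_right _ _).trans (le_max_left _ _), le_max_right _ _⟩
    · rintro _ ⟨j, ⟨hj, hj'⟩, rfl⟩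
      obtain ⟨d, v, rfl⟩ := j.exists_eq_mk
      rw [← W.ofDisk_unit, ← W.ofDisk_unit, W.ofDisk_onPathToBdry_iff] at hj hj'
      rw [Bulk.depth_mk_le_iff, he]
      refine max_le (max_le hj.1 hj'.1) ((norm_sub_le_max_sub z v w).trans (max_le hj.2 ?_))
      rw [norm_sub_rev]
      exact hj'.2
  rw [pathDist, hsup.csSup_eq, depth_mk, depth_mk, depth_mk, he]
  ring

/-- The bulk of `W` with the path metric. -/
abbrev Bulk.pathMetric (p : ℕ) [Fact p.Prime] : MetricSpace (Bulk p) where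
  dist := Bulk.pathDist
  dist_self q := by
    obtain ⟨z₀, z, rfl⟩ := q.exists_eq_mk
    rw [pathDist_mk_mk, max_self, sub_self, norm_zero, max_eq_left (norm_nonneg _)]
    ring
  dist_comm q q' := by
    obtain ⟨z₀, z, rfl⟩ := q.exists_eq_mk
    obtain ⟨w₀, w, rfl⟩ := q'.exists_eq_mk
    rw [pathDist_mk_mk, pathDist_mk_mk, norm_sub_rev w z, max_comm ‖(w₀ : ℂ_[p])‖]
    ring
  dist_triangle q₁ q₂ q₃ := by
    obtain ⟨x₀, x, rfl⟩ := q₁.exists_eq_mk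
    obtain ⟨y₀, y, rfl⟩ := q₂.exists_eq_mk
    obtain ⟨z₀, z, rfl⟩ := q₃.exists_eq_mk
    rw [pathDist_mk_mk, pathDist_mk_mk, pathDist_mk_mk]
    have hx : 0 < ‖(x₀ : ℂ_[p])‖ := norm_pos_iff.2 x₀.ne_zero
    have hy : 0 < ‖(y₀ : ℂ_[p])‖ := norm_pos_iff.2 y₀.ne_zero
    set M := max (max ‖(x₀ : ℂ_[p])‖ ‖(y₀ : ℂ_[p])‖) ‖x - y‖ with hM
    set N := max (max ‖(y₀ : ℂ_[p])‖ ‖(z₀ : ℂ_[p])‖) ‖y - z‖ with hN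
    set L := max (max ‖(x₀ : ℂ_[p])‖ ‖(z₀ : ℂ_[p])‖) ‖x - z‖ with hL
    have hxM : ‖(x₀ : ℂ_[p])‖ ≤ M := (le_max_left _ _).trans (le_max_left _ _)
    have hyM : ‖(y₀ : ℂ_[p])‖ ≤ M := (le_max_right _ _).trans (le_max_left _ _)
    have hyN : ‖(y₀ : ℂ_[p])‖ ≤ N := (le_max_left _ _).trans (le_max_left _ _)
    have hzN : ‖(z₀ : ℂ_[p])‖ ≤ N := (le_max_right _ _).trans (le_max_left _ _)
    have hLM : L ≤ max M N := max_le (max_le_max hxM hzN)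
      ((norm_sub_le_max_sub x y z).trans (max_le_max (le_max_right _ _) (le_max_right _ _)))
    have hL0 : 0 < L := hx.trans_le ((le_max_left _ _).trans (le_max_left _ _))
    have hlog : ∀ {s t : ℝ}, 0 < s → s ≤ t → Real.logb p s ≤ Real.logb p t :=
      fun hs hst => Real.logb_le_logb_of_le one_lt_prime hs hst
    -- Since `L ≤ max M N`, the larger of `M`, `N` absorbs `L`, and the smaller is still at least
    -- `‖y₀‖`.
    rcases le_total M N with h | h
    · linarith [hlog hy hyM, hlog hL0 (hLM.trans_eq (max_eq_right h))]
    · linarith [hlog hy hyN, hlog hL0 (hLM.trans_eq (max_eq_left h))]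
  eq_of_dist_eq_zero := by
    intro q q' h
    change q.pathDist q' = 0 at h
    obtain ⟨z₀, z, rfl⟩ := q.exists_eq_mk
    obtain ⟨w₀, w, rfl⟩ := q'.exists_eq_mk
    rw [pathDist_mk_mk] at h
    have hz : 0 < ‖(z₀ : ℂ_[p])‖ := norm_pos_iff.2 z₀.ne_zero
    have hw : 0 < ‖(w₀ : ℂ_[p])‖ := norm_pos_iff.2 w₀.ne_zero
    set M := max (max ‖(z₀ : ℂ_[p])‖ ‖(w₀ : ℂ_[p])‖) ‖z - w‖ with hM
    have hzM : ‖(z₀ : ℂ_[p])‖ ≤ M := (le_max_left _ _).trans (le_max_left _ _)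
    have hwM : ‖(w₀ : ℂ_[p])‖ ≤ M := (le_max_right _ _).trans (le_max_left _ _)
    have h1 := Real.logb_le_logb_of_le (b := p) one_lt_prime hz hzM
    have h2 := Real.logb_le_logb_of_le (b := p) one_lt_prime hw hwM
    -- The distance is a sum of two nonnegative gaps, so both vanish.
    have h3 : ‖(z₀ : ℂ_[p])‖ = M := Real.logb_injOn_pos one_lt_prime hz (hz.trans_le hzM)
      (by linarith)
    have h4 : ‖(w₀ : ℂ_[p])‖ = M := Real.logb_injOn_pos one_lt_prime hw (hw.trans_le hwM)
      (by linarith)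
    exact Bulk.mk_eq_mk_iff.2 ⟨h3.trans h4.symm, h3 ▸ le_max_right _ _⟩

end PadicBulk

end

theorem mainTheorem1 (p : ℕ) [Fact p.Prime] :
    -- every type II point is a disk `(a, p ^ i)` and every bulk point is of the form `(p ^ ω, z)`
    (∀ x : PadicBulk.HQ p, ∃ (a : ℂ_[p]) (i : ℚ),
      PadicBulk.IsDiskPoint x.1 a ((p : ℝ) ^ (i : ℝ))) ∧
    (∀ q : PadicBulk.Bulk p, ∃ (ω : ℚ) (z₀ : ℂ_[p]ˣ) (z : ℂ_[p]),
      PadicBulk.IsRatPow z₀ ω ∧ q = PadicBulk.Bulk.mk z₀ z) ∧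
    ∃ (φ : PadicBulk.HQ p ≃ₜ PadicBulk.Bulk p) (Φ : PadicBulk.TypeIOrII p ≃ₜ PadicBulk.W p),
      -- `φ (a, p ^ i) = (p ^ (-i), a)`
      (∀ (x : PadicBulk.HQ p) (a : ℂ_[p]) (i : ℚ) (z₀ : ℂ_[p]ˣ),
        PadicBulk.IsDiskPoint x.1 a ((p : ℝ) ^ (i : ℝ)) → PadicBulk.IsRatPow z₀ (-i) →
          φ x = PadicBulk.Bulk.mk z₀ a) ∧
      -- `φ⁻¹ (p ^ ω, z) = (z, p ^ (-ω))`
      (∀ (ω : ℚ) (z₀ : ℂ_[p]ˣ) (z : ℂ_[p]), PadicBulk.IsRatPow z₀ ω →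
        PadicBulk.IsDiskPoint (φ.symm (PadicBulk.Bulk.mk z₀ z)).1 z ((p : ℝ) ^ (-(ω : ℝ)))) ∧
      -- `Φ` extends `φ`, and `Φ (a, p ^ (-∞)) = (p ^ ∞, a)`, `Φ (0, p ^ ∞) = (p ^ (-∞), 0)`
      (∀ x : PadicBulk.HQ p, Φ ⟨x.1, Or.inr x.2⟩ = PadicBulk.W.bulk (φ x)) ∧
      (∀ (x : PadicBulk.TypeIOrII p) (a : ℂ_[p]), PadicBulk.IsDiskPoint x.1 a 0 →
        Φ x = PadicBulk.W.bdry a) ∧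
      (∀ x : PadicBulk.TypeIOrII p, x.1 = OnePoint.infty → Φ x = PadicBulk.W.root) ∧
      -- disk inclusion corresponds to lying on the path toward the boundary
      (∀ (x y : PadicBulk.TypeIOrII p) (B C : Set ℂ_[p]),
        PadicBulk.IsDiskOf x.1 B → PadicBulk.IsDiskOf y.1 C →
          (B ⊆ C ↔ (Φ x).OnPathToBdry (Φ y))) ∧
      -- `φ` is an isometry for the path metrics
      ∃ (mH : MetricSpace (PadicBulk.HQ p)) (mB : MetricSpace (PadicBulk.Bulk p)),
        (∀ (x y : PadicBulk.HQ p) (a b : ℂ_[p]) (r s : ℝ),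
          PadicBulk.IsDiskPoint x.1 a r → PadicBulk.IsDiskPoint y.1 b s →
            mH.dist x y =
              2 * Real.logb p (max (max r s) ‖a - b‖) - Real.logb p r - Real.logb p s) ∧
        (∀ q q' : PadicBulk.Bulk p, mB.dist q q' = q.pathDist q') ∧
        ∀ x y : PadicBulk.HQ p, mB.dist (φ x) (φ y) = mH.dist x y := by
  open PadicBulk in
  -- The metric on type II points is pulled back along `φ`, so the isometry is definitional and what
  -- remains is its explicit formula.
  refine ⟨fun x => ?_, fun q => ?_, Bulk.homeoHQ.symm, W.homeoTypeIOrII.symm, ?_, ?_, ?_, ?_, ?_,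
    ?_, .induced _ Bulk.homeoHQ.symm.injective (Bulk.pathMetric p), Bulk.pathMetric p, ?_,
    fun _ _ => rfl, fun _ _ => rfl⟩
  · obtain ⟨a, c, h⟩ := x.2
    obtain ⟨i, hi⟩ := exists_norm_eq_rpow c.ne_zero
    exact ⟨a, i, hi ▸ h⟩
  · obtain ⟨z₀, z, rfl⟩ := q.exists_eq_mk
    obtain ⟨i, hi⟩ := exists_norm_eq_rpow z₀.ne_zero
    obtain ⟨w₀, hw₀⟩ := exists_isRatPow (p := p) (-i)
    refine ⟨-i, w₀, z, hw₀, Bulk.mk_eq_mk_iff.2 ⟨?_, by simp⟩⟩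
    rw [hi, hw₀.norm_eq, Rat.cast_neg, neg_neg]
  · intro x a i z₀ h hz₀
    refine Bulk.homeoHQ_symm_eq_mk ?_
    rwa [hz₀.norm_eq, Rat.cast_neg, neg_neg]
  · intro ω z₀ z hz₀
    rw [← hz₀.norm_eq]
    exact isDiskPoint_diskPoint z z₀
  · intro x
    rw [Homeomorph.symm_apply_eq]
    refine Subtype.ext ?_
    rw [W.coe_homeoTypeIOrII, ← Bulk.coe_homeoHQ, Homeomorph.apply_symm_apply]
  · intro x a h
    exact W.homeoTypeIOrII.symm_apply_eq.2 (Subtype.ext h.toBerk_bdry.symm)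
  · intro x h
    exact W.homeoTypeIOrII.symm_apply_eq.2 (Subtype.ext h)
  · intro x y B D hB hD
    rw [hB.subset_iff_gauge_le hD, W.onPathToBdry_iff_gauge_le, W.toBerk_homeoTypeIOrII_symm,
      W.toBerk_homeoTypeIOrII_symm]
  · intro x y a b r s hx hy
    obtain ⟨c, rfl, hc⟩ := exists_bulk_mk_of_isDiskPoint x hx
    obtain ⟨d, rfl, hd⟩ := exists_bulk_mk_of_isDiskPoint y hy
    change (Bulk.homeoHQ.symm x).pathDist (Bulk.homeoHQ.symm y) = _
    rw [hc, hd, Bulk.pathDist_mk_mk]
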